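/- A graded poset is a finite poset $P$ with minimum $\hat 0$, maximum $\hat 1$ and a rank function $\rho:P\to\mathbb N$ with $\rho(\hat 0)=0$ and $\rho(y)=\rho(x)+1$ whenever $y$ covers $x$; its rank is $\rho(\hat 1)$. For real $k\neq 0$ the $k$-Möbius function of intervals of $P$ is defined recursively by $\mu_k([x,x])=1$ and $\mu_k([x,y])=-1-\frac1k\sum_{x<z<y}\mu_k([x,z])$ for $x<y$; $P$ is $k$-Eulerian if $\mu_k([x,y])=(-1)^{\rho(y)-\rho(x)}$ for all $x\le y$ in $P$. If $P$ has rank $n+1$ and $S\subseteq[1,n]=\{1,\dots,n\}$, then $f_S(P)$ denotes the number of chains of $P$ whose set of ranks is $S$. For a vector $f=(f_S)_{S\subseteq[1,n]}$ of real numbers put $$L^{k,n+1}_S(f)=(-1)^{n-|S|}\sum_{[1,n]\setminus S\subseteq T\subseteq[1,n]}\Bigl(-\frac1{2k}\Bigr)^{|T|}f_T ,$$ and write $L^{k,n+1}_S(P)$ for its value at $f=(f_S(P))_S$. A set $S\subseteq[1,n]$ is even if it is a disjoint union of intervals of even cardinality. A maximal gap of $S$ is a nonempty interval $[i,\ell]$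 that is inclusion-maximal among the intervals contained in $[1,n]\setminus S$. **Theorem (generalized Dehn–Sommerville equations).** Let $n\ge 0$ be an integer and $k\ne 0$ a real number. 1. For every $k$-Eulerian poset $P$ of rank $n+1$, every $S\subseteq[1,n]$ and every maximal gap $[i,\ell]$ of $S$, $$k\bigl((-1)^{i-1}+(-1)^{\ell+1}\bigr)f_S(P)+\sum_{j=i}^{\ell}(-1)^jf_{S\cup\{j\}}(P)=0 .\qquad(*)$$ 2. Suppose that $n=0$ or that $2k$ is a positive integer. If real numbers $(a_S)_{S\subseteq[1,n]}$ satisfy $\sum_{S\subseteq[1,n]}a_Sf_S(P)=0$ for all $k$-Eulerian posets $P$ of rank $n+1$, then the linear form $\sum_S a_Sf_S$ in the indeterminates $f_S$ is a real linear combination of the left-hand sides of the equations $(*)$. 3. A vector $(f_S)_{S\subseteq[1,n]}$ of real numbers satisfies all the equations $(*)$ (with $f_S$ in place of $f_S(P)$) if and only if $L^{k,n+1}_S(f)=0$ for every $S\subseteq[1,n]$ that is not even. In particular, $L^{k,n+1}_S(P)=0$ for every $k$-Eulerian poset $P$ of rank $n+1$ and every $S\subseteq[1,n]$ that is not even. 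-/

import Mathlib

universe u

/-! Graded posets (finite, with `⊥` and `⊤`, with a rank function `ρ` such that `ρ ⊥ = 0` and
`ρ y = ρ x + 1` whenever `y` covers `x`) are types with the instances `PartialOrder`, `BoundedOrder`,
`Fintype` and `GradeMinOrder ℕ`; the rank function is `grade ℕ`, the rank of the poset is
`grade ℕ ⊤`. The set `[1,n]` is `Finset.Icc 1 n : Finset ℕ`, and a vector indexed by the subsets
of `[1,n]` is (the restriction to these subsets of) a function on `Finset ℕ`. -/

section Posets

variable {P : Type*} [PartialOrder P] [Fintype P] [GradeMinOrder ℕ P]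

open Classical in
/-- The `k`-Möbius function of the interval `[x,y]` (meaningful for `x ≤ y`):
it is `1` if `x = y`, and `-1 - (1/k) ∑_{x < z < y} μ_k([x,z])` otherwise. -/
noncomputable def kMoebius {P : Type*} [PartialOrder P] [Fintype P] [GradeMinOrder ℕ P]
    (k : ℝ) (x y : P) : ℝ :=
  if x = y then 1
  else -1 - 1 / k * ∑ z : {z : P // x < z ∧ z < y}, kMoebius k x z.1
termination_by grade ℕ y
decreasing_by exact grade_strictMono z.2.2

theorem kMoebius_self (k : ℝ) (x : P) : kMoebius k x x = 1 := by
  rw [kMoebius, if_pos rfl]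

open Classical in
theorem kMoebius_of_ne (k : ℝ) {x y : P} (h : x ≠ y) :
    kMoebius k x y
      = -1 - 1 / k * ∑ z ∈ Finset.univ.filter (fun z : P => x < z ∧ z < y), kMoebius k x z := by
  rw [kMoebius, if_neg h]
  congr 2
  exact (Finset.sum_subtype _ (by simp) (fun z => kMoebius k x z)).symm

variable (P) in
/-- A graded poset is `k`-Eulerian if `μ_k([x,y]) = (-1)^{ρ(y) - ρ(x)}` for all its intervals. -/
def IsKEulerian (k : ℝ) : Prop :=
  ∀ x y : P, x ≤ y → kMoebius k x y = (-1) ^ (grade ℕ y - grade ℕ x)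

open Classical in
variable (P) in
/-- The flag number `f_S(P)`: the number of chains of `P` whose set of ranks is `S`. -/
noncomputable def flagNumber (S : Finset ℕ) : ℕ :=
  (Finset.univ.filter fun C : Finset P =>
    IsChain (· ≤ ·) (C : Set P) ∧ C.image (grade ℕ) = S).card

variable (P) in
/-- The flag `f`-vector of `P`, as a real vector. -/
noncomputable def flagVector (S : Finset ℕ) : ℝ := (flagNumber P S : ℝ)

end Posets

/-- `[i,l]` is a (nonempty) interval contained in `A`, and maximal among such intervals. -/
def IsMaximalInterval (A : Finset ℕ) (i l : ℕ) : Prop :=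
  i ≤ l ∧ Finset.Icc i l ⊆ A ∧
    ∀ i' l' : ℕ, Finset.Icc i l ⊆ Finset.Icc i' l' → Finset.Icc i' l' ⊆ A →
      Finset.Icc i' l' = Finset.Icc i l

/-- `[i,l]` is a maximal gap of `S` in `[1,n]`. -/
def IsMaximalGap (n : ℕ) (S : Finset ℕ) (i l : ℕ) : Prop :=
  IsMaximalInterval (Finset.Icc 1 n \ S) i l

/-- `S` is a disjoint union of intervals of even cardinality. -/
def IsEvenSet (S : Finset ℕ) : Prop :=
  ∃ F : Finset (Finset ℕ),
    (∀ I ∈ F, (∃ a b : ℕ, I = Finset.Icc a b) ∧ Even I.card) ∧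
    (F : Set (Finset ℕ)).PairwiseDisjoint id ∧
    F.biUnion id = S

/-- The `S`-entry of the `L^k`-vector (for rank `n + 1`) attached to the vector `f`:
`(-1)^{n - |S|} ∑_{[1,n] \ S ⊆ T ⊆ [1,n]} (-1/(2k))^{|T|} f_T`. -/
noncomputable def LVector (k : ℝ) (n : ℕ) (f : Finset ℕ → ℝ) (S : Finset ℕ) : ℝ :=
  (-1) ^ (n - S.card) *
    ∑ T ∈ (Finset.Icc 1 n).powerset.filter (fun T => Finset.Icc 1 n \ S ⊆ T),
      (-(1 / (2 * k))) ^ T.card * f T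

/-- The vector `f` satisfies the generalized Dehn–Sommerville equations
`k ((-1)^{i-1} + (-1)^{l+1}) f_S + ∑_{j=i}^{l} (-1)^j f_{S ∪ {j}} = 0`
for all `S ⊆ [1,n]` and all maximal gaps `[i,l]` of `S`. -/
def SatisfiesDehnSommerville (k : ℝ) (n : ℕ) (f : Finset ℕ → ℝ) : Prop :=
  ∀ S ⊆ Finset.Icc 1 n, ∀ i l : ℕ, IsMaximalGap n S i l →
    k * ((-1) ^ (i - 1) + (-1) ^ (l + 1)) * f S
      + ∑ j ∈ Finset.Icc i l, (-1) ^ j * f (S ∪ {j}) = 0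

/-- The left-hand side of a generalized Dehn–Sommerville equation as a formal linear combination
of the symbols `f_S`. -/
noncomputable def dehnSommervilleForm (k : ℝ) (S : Finset ℕ) (i l : ℕ) : Finset ℕ →₀ ℝ :=
  Finsupp.single S (k * ((-1) ^ (i - 1) + (-1) ^ (l + 1)))
    + ∑ j ∈ Finset.Icc i l, Finsupp.single (S ∪ {j}) ((-1) ^ j)

theorem linearCombination_dehnSommervilleForm (k : ℝ) (f : Finset ℕ → ℝ) (S : Finset ℕ)
    (i l : ℕ) :
    Finsupp.linearCombination ℝ f (dehnSommervilleForm k S i l)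
      = k * ((-1) ^ (i - 1) + (-1) ^ (l + 1)) * f S
        + ∑ j ∈ Finset.Icc i l, (-1) ^ j * f (S ∪ {j}) := by
  simp only [dehnSommervilleForm, map_add, map_sum, Finsupp.linearCombination_single, smul_eq_mul]

/-! The equations become transparent in the coordinates `LVector`. Inversion over the Boolean
lattice (`eq_sum_LVector`) gives `f T` as `(2k)^|T|` times the sum of `L_E` over the `E` disjoint
from `T`. The factor of `f S` in an equation is `-2k` times the alternating sum over the gap
`[i,l]`, so the equation says that the sum over `E` disjoint from `S` of `L_E * ∑ j ∈ E ∩ [i,l],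
(-1)^j` vanishes (`dehnSommerville_eq_sum_LVector`). An even `E` splits into pairs of neighbours,
each inside the gap or outside it, so its coefficient is `0`. For a non-even `E`, take `S` to be its
complement and the gap to be an odd maximal interval of `E`: then `L_E` has coefficient `±1`, and
induction on `E` gives `L_E = 0`.

Posets satisfy the equations because being `k`-Eulerian amounts to an identity for `∑ (-1)^ρ(z)`
over open intervals (`isKEulerian_iff`). The elements that extend a chain with rank set `S` at the
ranks of a gap form such an interval, with ends of ranks `i-1` and `l+1`; the identity is summed
over all these chains.

Completeness is a duality argument. A functional that kills the forms is a solution `f`, hence a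
combination of the vectors `T ↦ (2k)^|T| [T ∩ E = ∅]` with `E` even, and a relation valid on all
posets must annihilate these. For `m = 2k`, doubling some of the pairs of `E` in a chain and taking
`m` copies of each inner element gives a `k`-Eulerian `PairPoset` whose flag numbers are `m^|T|`
times `2` to the number of doubled pairs met by `T`. Varying the doubled pairs, these vectors span
the required one (`map_mul_prod_eq_zero`). -/

theorem two_mul_sum_Icc_neg_one_pow {i l : ℕ} (hi : 1 ≤ i) (h : i ≤ l + 1) :
    2 * ∑ j ∈ Finset.Icc i l, (-1 : ℝ) ^ j = -((-1) ^ (i - 1) + (-1) ^ (l + 1)) := by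
  induction l with
  | zero =>
    obtain rfl : i = 1 := by omega
    simp
  | succ l ih =>
    rcases Nat.lt_or_ge (l + 1) i with h' | h'
    · obtain rfl : i = l + 2 := by omega
      rw [Finset.Icc_eq_empty (by omega)]
      simp [pow_succ]
    · rw [Finset.sum_Icc_succ_top h', mul_add, ih h']
      ring

/-! ### Inverting the `L`-vector and rewriting the equations in its entries. -/

section Inversion

/-- Writing `W = T ∪ X` with `X ⊆ U \ T` reduces this to the alternating sum over a powerset; it is
the orthogonality behind the inversion. -/
theorem sum_Icc_neg_one_pow_card {T U : Finset ℕ} (h : T ⊆ U) :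
    ∑ W ∈ Finset.Icc T U, (-1 : ℝ) ^ W.card = if T = U then (-1) ^ T.card else 0 := by
  have hdisj : ∀ X ∈ (U \ T).powerset, Disjoint T X := fun X hX =>
    (Finset.disjoint_sdiff (s := T) (t := U)).mono_right (Finset.mem_powerset.1 hX)
  rw [Finset.Icc_eq_image_powerset h, Finset.sum_image]
  · have h1 : ∀ X ∈ (U \ T).powerset, (-1 : ℝ) ^ (T ∪ X).card
        = (-1) ^ T.card * ((-1 : ℤ) ^ X.card : ℤ) := by
      intro X hX
      rw [Finset.card_union_of_disjoint (hdisj X hX), pow_add]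
      push_cast
      rfl
    rw [Finset.sum_congr rfl h1, ← Finset.mul_sum, ← Int.cast_sum,
      Finset.sum_powerset_neg_one_pow_card]
    have h2 : U \ T = ∅ ↔ T = U := by
      rw [Finset.sdiff_eq_empty_iff_subset]
      exact ⟨fun h' => h.antisymm h', fun h' => h' ▸ subset_rfl⟩
    simp only [h2]
    split_ifs <;> simp
  · intro X hX Y hY hXY
    have hXY' : T ∪ X = T ∪ Y := hXY
    rw [← Finset.union_sdiff_cancel_left (hdisj X hX), hXY',
      Finset.union_sdiff_cancel_left (hdisj Y hY)]

/-- The flag vector is recovered from its `L`-vector. -/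
theorem eq_sum_LVector {k : ℝ} (hk : k ≠ 0) (n : ℕ) (f : Finset ℕ → ℝ) {T : Finset ℕ}
    (hT : T ⊆ Finset.Icc 1 n) :
    f T = (2 * k) ^ T.card * ∑ E ∈ (Finset.Icc 1 n \ T).powerset, LVector k n f E := by
  set N := Finset.Icc 1 n with hN
  have hNc : N.card = n := by simp [hN]
  -- Passing to the complement `W = N \ E` turns the sign `(-1)^(n - |E|)` into `(-1)^|W|`.
  have h1 : ∑ E ∈ (N \ T).powerset, LVector k n f E
      = ∑ W ∈ Finset.Icc T N, ∑ U ∈ Finset.Icc W N,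
          (-1) ^ W.card * ((-(1 / (2 * k))) ^ U.card * f U) := by
    refine Finset.sum_nbij' (fun E => N \ E) (fun W => N \ W) ?_ ?_ ?_ ?_ ?_
    · intro E hE
      rw [Finset.mem_powerset] at hE
      rw [Finset.mem_Icc]
      refine ⟨fun x hx => ?_, Finset.sdiff_subset⟩
      have := @hE x
      have := hT hx
      simp_all
    · intro W hW
      rw [Finset.mem_Icc] at hW
      exact Finset.mem_powerset.2 (Finset.sdiff_subset_sdiff subset_rfl hW.1)
    · intro E hE
      exact Finset.sdiff_sdiff_eq_self ((Finset.mem_powerset.1 hE).trans Finset.sdiff_subset)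
    · intro W hW
      exact Finset.sdiff_sdiff_eq_self (Finset.mem_Icc.1 hW).2
    · intro E hE
      have hEN : E ⊆ N := (Finset.mem_powerset.1 hE).trans Finset.sdiff_subset
      rw [LVector, ← Finset.mul_sum, Finset.card_sdiff_of_subset hEN, hNc]
      congr 1
      refine Finset.sum_congr ?_ fun _ _ => rfl
      ext U
      simp only [Finset.mem_filter, Finset.mem_powerset, Finset.mem_Icc]
      exact and_comm
  have h2 : ∑ W ∈ Finset.Icc T N, ∑ U ∈ Finset.Icc W N,
          (-1) ^ W.card * ((-(1 / (2 * k))) ^ U.card * f U)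
      = ∑ U ∈ Finset.Icc T N, ∑ W ∈ Finset.Icc T U,
          (-1) ^ W.card * ((-(1 / (2 * k))) ^ U.card * f U) := by
    refine Finset.sum_comm' fun W U => ?_
    simp only [Finset.mem_Icc]
    exact ⟨fun h => ⟨⟨h.1.1, h.2.1⟩, h.1.1.trans h.2.1, h.2.2⟩,
      fun h => ⟨⟨h.1.1, h.1.2.trans h.2.2⟩, h.1.2, h.2.2⟩⟩
  have h3 : ∀ U ∈ Finset.Icc T N, ∑ W ∈ Finset.Icc T U,
          (-1) ^ W.card * ((-(1 / (2 * k))) ^ U.card * f U)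
      = if T = U then (-1) ^ T.card * ((-(1 / (2 * k))) ^ T.card * f T) else 0 := by
    intro U hU
    rw [← Finset.sum_mul, sum_Icc_neg_one_pow_card (Finset.mem_Icc.1 hU).1]
    split_ifs with h
    · rw [h]
    · rw [zero_mul]
  rw [h1, h2, Finset.sum_congr rfl h3, Finset.sum_ite_eq,
    if_pos (Finset.mem_Icc.2 ⟨le_rfl, hT⟩), ← mul_assoc, ← mul_assoc, ← mul_pow, ← mul_pow]
  rw [show 2 * k * -1 * -(1 / (2 * k)) = 1 by field_simp, one_pow, one_mul]

/-- The Dehn–Sommerville expression in terms of the `L`-vector. -/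
theorem dehnSommerville_eq_sum_LVector {k : ℝ} (hk : k ≠ 0) (n : ℕ) (f : Finset ℕ → ℝ)
    {S : Finset ℕ} (hS : S ⊆ Finset.Icc 1 n) {i l : ℕ} (hil : i ≤ l)
    (hgap : Finset.Icc i l ⊆ Finset.Icc 1 n \ S) :
    k * ((-1) ^ (i - 1) + (-1) ^ (l + 1)) * f S
      + ∑ j ∈ Finset.Icc i l, (-1) ^ j * f (S ∪ {j})
    = -(2 * k) ^ (S.card + 1) * ∑ E ∈ (Finset.Icc 1 n \ S).powerset,
        LVector k n f E * ∑ j ∈ E ∩ Finset.Icc i l, (-1) ^ j := by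
  set N := Finset.Icc 1 n with hN
  have hi : 1 ≤ i := by
    have := hgap (Finset.left_mem_Icc.2 hil)
    simp only [hN, Finset.mem_sdiff, Finset.mem_Icc] at this
    exact this.1.1
  -- Terms with `j ∈ E` are included as zeros, so that all `j` share the index set of `f S`.
  have h1 : ∀ j ∈ Finset.Icc i l, (-1) ^ j * f (S ∪ {j})
      = (2 * k) ^ (S.card + 1) * ∑ E ∈ (N \ S).powerset,
          if j ∈ E then 0 else LVector k n f E * (-1) ^ j := by
    intro j hj
    have hj' := Finset.mem_sdiff.1 (hgap hj)
    have hsub : S ∪ {j} ⊆ N := Finset.union_subset hS (Finset.singleton_subset_iff.2 hj'.1)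
    have hcard : (S ∪ {j}).card = S.card + 1 := by
      rw [Finset.union_comm, ← Finset.insert_eq, Finset.card_insert_of_notMem hj'.2]
    rw [eq_sum_LVector hk n f hsub, hcard, mul_left_comm, Finset.mul_sum]
    congr 1
    have hite : ∀ E : Finset ℕ, (if j ∈ E then 0 else LVector k n f E * (-1) ^ j)
        = if j ∉ E then (-1) ^ j * LVector k n f E else 0 := fun E => by
      rw [ite_not, mul_comm]
    simp only [hite]
    rw [← Finset.sum_filter]
    refine Finset.sum_congr ?_ fun _ _ => rfl
    ext E
    simp only [Finset.mem_powerset, Finset.mem_filter, Finset.subset_iff, Finset.mem_sdiff,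
      Finset.mem_union, Finset.mem_singleton]
    refine ⟨fun h => ⟨fun x hx => ⟨(h hx).1, fun hxS => (h hx).2 (Or.inl hxS)⟩,
      fun hjE => (h hjE).2 (Or.inr rfl)⟩, fun h x hx => ⟨(h.1 hx).1, ?_⟩⟩
    rintro (hxS | rfl)
    · exact (h.1 hx).2 hxS
    · exact h.2 hx
  rw [Finset.sum_congr rfl h1, ← Finset.mul_sum, Finset.sum_comm, eq_sum_LVector hk n f hS]
  have h2 : ∀ E : Finset ℕ, (∑ j ∈ Finset.Icc i l, if j ∈ E then 0 else LVector k n f E * (-1) ^ j)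
      = LVector k n f E * (∑ j ∈ Finset.Icc i l, (-1) ^ j)
        - LVector k n f E * ∑ j ∈ E ∩ Finset.Icc i l, (-1) ^ j := by
    intro E
    rw [Finset.inter_comm, ← Finset.filter_mem_eq_inter, Finset.sum_filter, ← mul_sub,
      ← Finset.sum_sub_distrib, Finset.mul_sum]
    refine Finset.sum_congr rfl fun j _ => ?_
    split_ifs <;> simp
  simp only [h2]
  rw [Finset.sum_sub_distrib, ← Finset.sum_mul]
  have h3 := two_mul_sum_Icc_neg_one_pow hi (hil.trans (Nat.le_succ l))
  rw [pow_succ]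
  linear_combination (2 * k) ^ S.card * k * (∑ E ∈ (N \ S).powerset, LVector k n f E) * h3

end Inversion

/-! ### Even sets, maximal intervals and alternating sums. -/

section EvenSets

/-- `E` is the union of the disjoint pairs `{a, a + 1}` with `a ∈ A`. -/
structure IsPairing (A E : Finset ℕ) : Prop where
  mem_iff : ∀ x, x ∈ E ↔ x ∈ A ∨ ∃ a ∈ A, x = a + 1
  succ_notMem : ∀ a ∈ A, a + 1 ∉ A

/-- In each interval `[a,b]` of the decomposition, the elements at even distance from `a` start the
pairs. -/
theorem IsEvenSet.exists_isPairing {E : Finset ℕ} (hE : IsEvenSet E) : ∃ A, IsPairing A E := by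
  classical
  obtain ⟨F, hF, hdisj, rfl⟩ := hE
  -- An element at even offset in an interval of even size cannot be its last.
  have hsucc : ∀ a b x : ℕ, Finset.Icc a b ∈ F → a ≤ x → x ≤ b → Even (x - a) → x + 1 ≤ b := by
    intro a b x hI hax hxb hev
    by_contra hlt
    obtain rfl : x = b := by omega
    have h := (hF _ hI).2
    rw [Nat.card_Icc] at h
    rw [Nat.even_iff] at h hev
    omega
  refine ⟨(F.biUnion id).filter fun x => ∃ a b, Finset.Icc a b ∈ F ∧ a ≤ x ∧ x ≤ b ∧
    Even (x - a), ?_, ?_⟩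
  · intro x
    constructor
    · intro hx
      obtain ⟨I, hI, hxI⟩ := Finset.mem_biUnion.1 hx
      obtain ⟨⟨a, b, rfl⟩, hev⟩ := hF I hI
      obtain ⟨hax, hxb⟩ := Finset.mem_Icc.1 hxI
      by_cases h : Even (x - a)
      · exact Or.inl (Finset.mem_filter.2 ⟨hx, a, b, hI, hax, hxb, h⟩)
      · have h0 : a < x := by
          rcases hax.eq_or_lt with rfl | h'
          · simp at h
          · exact h'
        rw [Nat.even_iff] at h
        refine Or.inr ⟨x - 1, Finset.mem_filter.2 ⟨Finset.mem_biUnion.2 ⟨_, hI, ?_⟩,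
          a, b, hI, by omega, by omega, ?_⟩, by omega⟩
        · exact Finset.mem_Icc.2 ⟨by omega, by omega⟩
        · rw [Nat.even_iff]; omega
    · rintro (hx | ⟨y, hy, rfl⟩)
      · exact (Finset.mem_filter.1 hx).1
      · obtain ⟨-, a, b, hI, hay, hyb, hev⟩ := Finset.mem_filter.1 hy
        exact Finset.mem_biUnion.2 ⟨_, hI,
          Finset.mem_Icc.2 ⟨by omega, hsucc a b y hI hay hyb hev⟩⟩
  · intro x hx hx'
    obtain ⟨-, a, b, hI, hax, hxb, hev⟩ := Finset.mem_filter.1 hx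
    obtain ⟨-, a', b', hI', hax', hxb', hev'⟩ := Finset.mem_filter.1 hx'
    have hb := hsucc a b x hI hax hxb hev
    have heq : Finset.Icc a b = Finset.Icc a' b' := by
      by_contra hne
      exact Finset.disjoint_left.1 (hdisj hI hI' hne)
        (Finset.mem_Icc.2 ⟨by omega, hb⟩ : x + 1 ∈ Finset.Icc a b)
        (Finset.mem_Icc.2 ⟨hax', hxb'⟩)
    have h1 : a ∈ Finset.Icc a' b' := heq ▸ Finset.left_mem_Icc.2 (by omega)
    have h2 : a' ∈ Finset.Icc a b := heq ▸ Finset.left_mem_Icc.2 (by omega)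
    rw [Finset.mem_Icc] at h1 h2
    rw [Nat.even_iff] at hev hev'
    omega

theorem exists_isMaximalInterval {A : Finset ℕ} {x : ℕ} (hx : x ∈ A) :
    ∃ i l, IsMaximalInterval A i l ∧ x ∈ Finset.Icc i l := by
  classical
  obtain ⟨I, hI, hmax⟩ := (A.powerset.filter fun I => x ∈ I ∧ ∃ i l, I = Finset.Icc i l).exists_max_image
    Finset.card ⟨{x}, by
      simp only [Finset.mem_filter, Finset.mem_powerset, Finset.singleton_subset_iff,
        Finset.mem_singleton, true_and]
      exact ⟨hx, x, x, by simp⟩⟩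
  simp only [Finset.mem_filter, Finset.mem_powerset] at hI hmax
  obtain ⟨hIA, hxI, i, l, rfl⟩ := hI
  refine ⟨i, l, ⟨Finset.nonempty_Icc.1 ⟨x, hxI⟩, hIA, fun i' l' hsub hA => ?_⟩, hxI⟩
  exact (Finset.eq_of_subset_of_card_le hsub (hmax _ ⟨hA, hsub hxI, i', l', rfl⟩)).symm

/-- For `i = 0`, truncated subtraction would make `i - 1` the endpoint itself, hence `1 ≤ i`. -/
theorem IsMaximalInterval.left_notMem {A : Finset ℕ} {i l : ℕ} (h : IsMaximalInterval A i l)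
    (hi : 1 ≤ i) : i - 1 ∉ A := by
  intro hmem
  obtain ⟨hil, hsub, hmax⟩ := h
  have h1 := hmax (i - 1) l (Finset.Icc_subset_Icc (by omega) le_rfl) fun y hy => by
    rw [Finset.mem_Icc] at hy
    rcases Nat.lt_or_ge y i with h' | h'
    · rwa [show y = i - 1 by omega]
    · exact hsub (Finset.mem_Icc.2 ⟨h', hy.2⟩)
  have h2 : i - 1 ∈ Finset.Icc i l := h1 ▸ Finset.left_mem_Icc.2 (by omega)
  rw [Finset.mem_Icc] at h2
  omega

theorem IsMaximalInterval.right_notMem {A : Finset ℕ} {i l : ℕ} (h : IsMaximalInterval A i l) :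
    l + 1 ∉ A := by
  intro hmem
  obtain ⟨hil, hsub, hmax⟩ := h
  have h1 := hmax i (l + 1) (Finset.Icc_subset_Icc le_rfl (by omega)) fun y hy => by
    rw [Finset.mem_Icc] at hy
    rcases Nat.lt_or_ge l y with h' | h'
    · rwa [show y = l + 1 by omega]
    · exact hsub (Finset.mem_Icc.2 ⟨hy.1, h'⟩)
  have h2 : l + 1 ∈ Finset.Icc i l := h1 ▸ Finset.right_mem_Icc.2 (by omega)
  rw [Finset.mem_Icc] at h2
  omega

/-- The union of two intervals with a common point is an interval, so both equal it by maximality.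
-/
theorem IsMaximalInterval.eq_of_mem {A : Finset ℕ} {i l i' l' x : ℕ}
    (h : IsMaximalInterval A i l) (h' : IsMaximalInterval A i' l')
    (hx : x ∈ Finset.Icc i l) (hx' : x ∈ Finset.Icc i' l') :
    Finset.Icc i l = Finset.Icc i' l' := by
  rw [Finset.mem_Icc] at hx hx'
  have hA : Finset.Icc (min i i') (max l l') ⊆ A := by
    intro y hy
    rw [Finset.mem_Icc] at hy
    by_cases hy' : y ∈ Finset.Icc i l
    · exact h.2.1 hy'
    · rw [Finset.mem_Icc] at hy'
      exact h'.2.1 (Finset.mem_Icc.2 ⟨by omega, by omega⟩)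
  rw [← h.2.2 _ _ (Finset.Icc_subset_Icc (min_le_left i i') (le_max_left l l')) hA,
    ← h'.2.2 _ _ (Finset.Icc_subset_Icc (min_le_right i i') (le_max_right l l')) hA]

/-- A set that is not even has a maximal interval of odd cardinality. -/
theorem exists_odd_maximalInterval {E : Finset ℕ} (hE : ¬ IsEvenSet E) :
    ∃ i l, IsMaximalInterval E i l ∧ Odd (Finset.Icc i l).card := by
  classical
  by_contra! hcon
  apply hE
  refine ⟨E.powerset.filter fun I => ∃ i l, IsMaximalInterval E i l ∧ I = Finset.Icc i l,
    ?_, ?_, ?_⟩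
  · intro I hI
    obtain ⟨-, i, l, hil, rfl⟩ := Finset.mem_filter.1 hI
    exact ⟨⟨i, l, rfl⟩, Nat.not_odd_iff_even.1 (hcon i l hil)⟩
  · intro I hI J hJ hne
    obtain ⟨-, i, l, hil, rfl⟩ := Finset.mem_filter.1 hI
    obtain ⟨-, i', l', hil', rfl⟩ := Finset.mem_filter.1 hJ
    exact Finset.disjoint_left.2 fun x hx hx' => hne (hil.eq_of_mem hil' hx hx')
  · ext x
    simp only [Finset.mem_biUnion, Finset.mem_filter, Finset.mem_powerset, id]
    constructor
    · rintro ⟨I, ⟨hI, -⟩, hx⟩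
      exact hI hx
    · intro hx
      obtain ⟨i, l, hil, hxI⟩ := exists_isMaximalInterval hx
      exact ⟨_, ⟨hil.2.1, i, l, hil, rfl⟩, hxI⟩

/-- Modulo 2 every summand is `1`, so the sum has the parity of the cardinality. -/
theorem sum_Icc_neg_one_pow_ne_zero {i l : ℕ} (h : Odd (Finset.Icc i l).card) :
    ∑ j ∈ Finset.Icc i l, (-1 : ℝ) ^ j ≠ 0 := by
  intro h0
  have h1 : ((∑ j ∈ Finset.Icc i l, (-1 : ℤ) ^ j : ℤ) : ZMod 2) = ((Finset.Icc i l).card : ZMod 2) := by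
    push_cast
    have : (-1 : ZMod 2) = 1 := by decide
    simp [this]
  have h2 : ∑ j ∈ Finset.Icc i l, (-1 : ℤ) ^ j = 0 := by exact_mod_cast h0
  rw [h2, Int.cast_zero, (ZMod.natCast_eq_one_iff_odd).2 h] at h1
  exact zero_ne_one h1

/-- A pair `{a, a + 1}` contained in `B` lies inside or outside a maximal interval of `B`, and
`(-1)^a + (-1)^(a+1) = 0`. -/
theorem sum_even_inter_gap {E B : Finset ℕ} (hE : IsEvenSet E) (hEB : E ⊆ B) {i l : ℕ}
    (h : IsMaximalInterval B i l) : ∑ j ∈ E ∩ Finset.Icc i l, (-1 : ℝ) ^ j = 0 := by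
  classical
  obtain ⟨A, hA⟩ := hE.exists_isPairing
  have hset : E ∩ Finset.Icc i l
      = (A ∩ Finset.Icc i l) ∪ (A ∩ Finset.Icc i l).image (· + 1) := by
    ext x
    simp only [Finset.mem_inter, Finset.mem_union, Finset.mem_image, Finset.mem_Icc]
    constructor
    · rintro ⟨hx, hix, hxl⟩
      rcases (hA.mem_iff x).1 hx with hxA | ⟨a, ha, rfl⟩
      · exact Or.inl ⟨hxA, hix, hxl⟩
      · refine Or.inr ⟨a, ⟨ha, ?_, by omega⟩, rfl⟩
        by_contra hlt
        have haB : a ∈ B := hEB ((hA.mem_iff a).2 (Or.inl ha))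
        exact h.left_notMem (by omega) (by rwa [show i - 1 = a by omega])
    · rintro (⟨hxA, hix, hxl⟩ | ⟨a, ⟨ha, hia, hal⟩, rfl⟩)
      · exact ⟨(hA.mem_iff x).2 (Or.inl hxA), hix, hxl⟩
      · have haE : a + 1 ∈ E := (hA.mem_iff _).2 (Or.inr ⟨a, ha, rfl⟩)
        refine ⟨haE, by omega, ?_⟩
        by_contra hlt
        exact h.right_notMem (by rw [show l + 1 = a + 1 by omega]; exact hEB haE)
  rw [hset, Finset.sum_union, Finset.sum_image (fun a _ b _ hab => by simpa using hab),
    ← Finset.sum_add_distrib]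
  · exact Finset.sum_eq_zero fun a _ => by ring
  · rw [Finset.disjoint_left]
    intro x hx hx'
    obtain ⟨a, ha, rfl⟩ := Finset.mem_image.1 hx'
    exact hA.succ_notMem a (Finset.mem_inter.1 ha).1 (Finset.mem_inter.1 hx).1

end EvenSets

/-- The Dehn–Sommerville equations are equivalent to the vanishing of the non-even part of the
`L`-vector. -/
theorem satisfiesDehnSommerville_iff {k : ℝ} (hk : k ≠ 0) (n : ℕ) (f : Finset ℕ → ℝ) :
    SatisfiesDehnSommerville k n f ↔
      ∀ S ⊆ Finset.Icc 1 n, ¬ IsEvenSet S → LVector k n f S = 0 := by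
  constructor
  · intro hf E
    induction E using Finset.strongInduction with
    | H E ih =>
      intro hEN hE
      -- In the equation for the complement of `E` and this gap, even subsets of `E` cancel and
      -- proper non-even ones vanish by induction; only `L_E` survives.
      obtain ⟨i, l, hil, hodd⟩ := exists_odd_maximalInterval hE
      have hcompl : Finset.Icc 1 n \ (Finset.Icc 1 n \ E) = E := Finset.sdiff_sdiff_eq_self hEN
      have hgap : IsMaximalGap n (Finset.Icc 1 n \ E) i l := by
        rw [IsMaximalGap, hcompl]
        exact hil
      have h := hf _ Finset.sdiff_subset i l hgap
      rw [dehnSommerville_eq_sum_LVector hk n f Finset.sdiff_subset hil.1 hgap.2.1, hcompl,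
        Finset.sum_eq_single E] at h
      · rw [Finset.inter_eq_right.2 hil.2.1] at h
        have hpow : -(2 * k) ^ ((Finset.Icc 1 n \ E).card + 1) ≠ 0 :=
          neg_ne_zero.2 (pow_ne_zero _ (mul_ne_zero two_ne_zero hk))
        exact (mul_eq_zero.1 ((mul_eq_zero.1 h).resolve_left hpow)).resolve_right
          (sum_Icc_neg_one_pow_ne_zero hodd)
      · intro E' hE' hne
        have hsub := Finset.mem_powerset.1 hE'
        by_cases hev : IsEvenSet E'
        · rw [sum_even_inter_gap hev hsub hil, mul_zero]
        · rw [ih E' (hsub.ssubset_of_ne hne) (hsub.trans hEN) hev, zero_mul]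
      · exact fun hnot => absurd (Finset.mem_powerset_self E) hnot
  · intro hL S hS i l hgap
    rw [dehnSommerville_eq_sum_LVector hk n f hS hgap.1 hgap.2.1, Finset.sum_eq_zero, mul_zero]
    intro E hE
    have hsub := Finset.mem_powerset.1 hE
    by_cases hev : IsEvenSet E
    · rw [sum_even_inter_gap hev hsub hgap, mul_zero]
    · rw [hL E (hsub.trans Finset.sdiff_subset) hev, zero_mul]

/-! ### The `k`-Eulerian condition through open intervals. -/

section KEulerian

variable {P : Type*} [PartialOrder P] [Fintype P] [GradeMinOrder ℕ P]

theorem neg_one_pow_sub_eq {a b : ℕ} (h : a ≤ b) : (-1 : ℝ) ^ (b - a) = (-1) ^ a * (-1) ^ b := by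
  obtain ⟨c, rfl⟩ := Nat.exists_eq_add_of_le h
  rw [Nat.add_sub_cancel_left, pow_add, ← mul_assoc, ← mul_pow]
  simp

open Classical in
/-- The `k`-Eulerian property as a condition on alternating sums over open intervals. -/
theorem isKEulerian_iff {k : ℝ} (hk : k ≠ 0) :
    IsKEulerian P k ↔ ∀ x y : P, x < y →
      ∑ z ∈ Finset.univ.filter (fun z : P => x < z ∧ z < y), (-1 : ℝ) ^ grade ℕ z
        = -k * ((-1) ^ grade ℕ x + (-1) ^ grade ℕ y) := by
  have hsq : ∀ a : ℕ, (-1 : ℝ) ^ a * (-1) ^ a = 1 := fun a => by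
    rw [← mul_pow]; simp
  -- One unfolding of the recursion: once the inner values are known, the value at `y` is equivalent
  -- to the sum identity.
  have key : ∀ x y : P, x < y →
      (∀ z, x < z → z < y → kMoebius k x z = (-1) ^ (grade ℕ z - grade ℕ x)) →
      (kMoebius k x y = (-1) ^ (grade ℕ y - grade ℕ x) ↔
      ∑ z ∈ Finset.univ.filter (fun z : P => x < z ∧ z < y), (-1 : ℝ) ^ grade ℕ z
        = -k * ((-1) ^ grade ℕ x + (-1) ^ grade ℕ y)) := by
    intro x y hxy hz
    have hsum : ∑ z ∈ Finset.univ.filter (fun z : P => x < z ∧ z < y), kMoebius k x z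
        = (-1) ^ grade ℕ x *
          ∑ z ∈ Finset.univ.filter (fun z : P => x < z ∧ z < y), (-1 : ℝ) ^ grade ℕ z := by
      rw [Finset.mul_sum]
      refine Finset.sum_congr rfl fun z hz' => ?_
      obtain ⟨-, h1, h2⟩ := Finset.mem_filter.1 hz'
      rw [hz z h1 h2, neg_one_pow_sub_eq (grade_mono (𝕆 := ℕ) h1.le)]
    rw [kMoebius_of_ne k hxy.ne, hsum, neg_one_pow_sub_eq (grade_mono (𝕆 := ℕ) hxy.le)]
    set s := ∑ z ∈ Finset.univ.filter (fun z : P => x < z ∧ z < y), (-1 : ℝ) ^ grade ℕ z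
    have hx := hsq (grade ℕ x)
    set a := (-1 : ℝ) ^ grade ℕ x
    set b := (-1 : ℝ) ^ grade ℕ y
    constructor
    · intro h
      field_simp at h
      linear_combination (-a) * h + (-s - b * k) * hx
    · intro h
      rw [h]
      field_simp
      linear_combination hx
  constructor
  · intro h x y hxy
    exact (key x y hxy fun z hz _ => h x z hz.le).1 (h x y hxy.le)
  · intro h x y
    induction hn : grade ℕ y using Nat.strong_induction_on generalizing y with
    | _ n ih =>
      intro hxy
      subst hn
      rcases hxy.eq_or_lt with rfl | hlt
      · rw [kMoebius_self, Nat.sub_self, pow_zero]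
      · exact (key x y hlt fun z hxz hzy => ih _ (grade_strictMono hzy) z rfl hxz.le).2 (h x y hlt)

end KEulerian

/-! ### Flag numbers, and the equations for posets. -/

section Flags

variable {P : Type*} [PartialOrder P] [Fintype P] [GradeMinOrder ℕ P]

open Classical in
variable (P) in
/-- The chains of `P` with rank set `S`. -/
noncomputable def flags (S : Finset ℕ) : Finset (Finset P) :=
  Finset.univ.filter fun C : Finset P => IsChain (· ≤ ·) (C : Set P) ∧ C.image (grade ℕ) = S

theorem flagNumber_eq_card (S : Finset ℕ) : flagNumber P S = (flags P S).card := rfl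

theorem mem_flags {S : Finset ℕ} {C : Finset P} :
    C ∈ flags P S ↔ IsChain (· ≤ ·) (C : Set P) ∧ C.image (grade ℕ) = S := by
  simp [flags]

theorem grade_mem_of_mem_flags {S : Finset ℕ} {C : Finset P} (hC : C ∈ flags P S) {x : P}
    (hx : x ∈ C) : grade ℕ x ∈ S :=
  (mem_flags.1 hC).2 ▸ Finset.mem_image_of_mem _ hx

theorem exists_mem_of_mem_flags {S : Finset ℕ} {C : Finset P} (hC : C ∈ flags P S) {r : ℕ}
    (hr : r ∈ S) : ∃ x ∈ C, grade ℕ x = r :=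
  Finset.mem_image.1 ((mem_flags.1 hC).2.symm ▸ hr)

theorem lt_of_grade_lt_of_comparable {Q : Type*} [PartialOrder Q] [GradeMinOrder ℕ Q] {x y : Q}
    (h : x ≤ y ∨ y ≤ x) (hlt : grade ℕ x < grade ℕ y) :
    x < y := by
  rcases h with h | h
  · exact lt_of_le_of_ne h fun he => by simp [he] at hlt
  · exact absurd (grade_mono (𝕆 := ℕ) h) (not_le.2 hlt)

theorem lt_of_mem_flags {S : Finset ℕ} {C : Finset P} (hC : C ∈ flags P S) {x y : P}
    (hx : x ∈ C) (hy : y ∈ C) (hlt : grade ℕ x < grade ℕ y) : x < y :=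
  lt_of_grade_lt_of_comparable
    ((mem_flags.1 hC).1.total (Finset.mem_coe.2 hx) (Finset.mem_coe.2 hy)) hlt

theorem flagNumber_empty : flagNumber P ∅ = 1 := by
  rw [flagNumber_eq_card, Finset.card_eq_one]
  refine ⟨∅, Finset.ext fun C => ?_⟩
  rw [mem_flags, Finset.image_eq_empty, Finset.mem_singleton]
  exact ⟨fun h => h.2, fun h => ⟨by simp [h], h⟩⟩

open Classical in
/-- The elements of rank `t` that are comparable with all elements of `C`. -/
noncomputable def extensions (C : Finset P) (t : ℕ) : Finset P :=
  Finset.univ.filter fun z => grade ℕ z = t ∧ ∀ c ∈ C, c < z ∨ z < c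

theorem mem_extensions {C : Finset P} {t : ℕ} {z : P} :
    z ∈ extensions C t ↔ grade ℕ z = t ∧ ∀ c ∈ C, c < z ∨ z < c := by
  simp [extensions]

/-- Deleting the unique element of rank `t` from a chain inverts the insertion of an extension. -/
theorem flagNumber_insert {T : Finset ℕ} {t : ℕ} (ht : t ∉ T) :
    flagNumber P (insert t T) = ∑ C ∈ flags P T, (extensions C t).card := by
  classical
  rw [flagNumber_eq_card, ← Finset.card_sigma]
  symm
  have hins : ∀ C ∈ flags P T, ∀ z ∈ extensions C t, insert z C ∈ flags P (insert t T) := by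
    intro C hC z hz
    rw [mem_extensions] at hz
    rw [mem_flags] at hC ⊢
    refine ⟨?_, by rw [Finset.image_insert, hz.1, hC.2]⟩
    rw [Finset.coe_insert]
    refine hC.1.insert fun c hc _ => ?_
    exact (hz.2 c hc).symm.imp le_of_lt le_of_lt
  have hfil : ∀ C ∈ flags P T, ∀ z ∈ extensions C t,
      (insert z C).filter (fun x => grade ℕ x ≠ t) = C := by
    intro C hC z hz
    rw [mem_extensions] at hz
    rw [Finset.filter_insert, if_neg (not_not.2 hz.1), Finset.filter_true_of_mem]
    rintro x hx rfl
    exact ht (grade_mem_of_mem_flags hC hx)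
  refine Finset.card_bij (fun p _ => insert p.2 p.1) ?_ ?_ ?_
  · rintro ⟨C, z⟩ h
    rw [Finset.mem_sigma] at h
    exact hins C h.1 z h.2
  · rintro ⟨C, z⟩ h ⟨C', z'⟩ h' heq
    rw [Finset.mem_sigma] at h h'
    dsimp only at h h' heq
    obtain rfl : C = C' := by
      rw [← hfil C h.1 z h.2, heq, hfil C' h'.1 z' h'.2]
    have hz : z ∈ insert z' C := heq ▸ Finset.mem_insert_self z C
    rcases Finset.mem_insert.1 hz with rfl | hzC
    · rfl
    · exact absurd ((mem_extensions.1 h.2).1 ▸ grade_mem_of_mem_flags h.1 hzC) ht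
  · intro D hD
    obtain ⟨z, hzD, hz⟩ := exists_mem_of_mem_flags hD (Finset.mem_insert_self t T)
    have huniq : ∀ x ∈ D, grade ℕ x = t → x = z := by
      intro x hx hxt
      rcases (mem_flags.1 hD).1.total (Finset.mem_coe.2 hx) (Finset.mem_coe.2 hzD) with h | h
      · by_contra hne
        have := grade_strictMono (𝕆 := ℕ) (lt_of_le_of_ne h hne)
        omega
      · by_contra hne
        have := grade_strictMono (𝕆 := ℕ) (lt_of_le_of_ne h (Ne.symm hne))
        omega
    have hC : D.filter (fun x => grade ℕ x ≠ t) ∈ flags P T := by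
      rw [mem_flags]
      refine ⟨(mem_flags.1 hD).1.mono (Finset.coe_subset.2 (Finset.filter_subset _ _)), Finset.ext fun r => ?_⟩
      simp only [Finset.mem_image, Finset.mem_filter]
      constructor
      · rintro ⟨x, ⟨hx, hxt⟩, rfl⟩
        exact (Finset.mem_insert.1 (grade_mem_of_mem_flags hD hx)).resolve_left hxt
      · intro hr
        obtain ⟨x, hx, rfl⟩ := exists_mem_of_mem_flags hD (Finset.mem_insert_of_mem hr)
        exact ⟨x, ⟨hx, fun he => ht (he ▸ hr)⟩, rfl⟩
    refine ⟨⟨D.filter (fun x => grade ℕ x ≠ t), z⟩, Finset.mem_sigma.2 ⟨hC, ?_⟩, ?_⟩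
    · refine mem_extensions.2 ⟨hz, fun c hc => ?_⟩
      obtain ⟨hcD, hct⟩ := Finset.mem_filter.1 hc
      rcases lt_or_gt_of_ne hct with h | h
      · exact Or.inl (lt_of_mem_flags hD hcD hzD (hz ▸ h))
      · exact Or.inr (lt_of_mem_flags hD hzD hcD (hz ▸ h))
    · ext x
      simp only [Finset.mem_insert, Finset.mem_filter]
      constructor
      · rintro (rfl | h)
        · exact hzD
        · exact h.1
      · intro hx
        by_cases hxt : grade ℕ x = t
        · exact Or.inl (huniq x hx hxt)
        · exact Or.inr ⟨hx, hxt⟩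

variable [BoundedOrder P]

/-- The flag vector of a `k`-Eulerian poset satisfies the Dehn–Sommerville equations. -/
theorem IsKEulerian.satisfiesDehnSommerville {k : ℝ} (hk : k ≠ 0) {n : ℕ}
    (hn : grade ℕ (⊤ : P) = n + 1) (hP : IsKEulerian P k) :
    SatisfiesDehnSommerville k n (flagVector P) := by
  classical
  intro S hS i l hgap
  have hil := hgap.1
  have hmem : ∀ j ∈ Finset.Icc i l, j ∈ Finset.Icc 1 n ∧ j ∉ S := fun j hj =>
    Finset.mem_sdiff.1 (hgap.2.1 hj)
  have hi : 1 ≤ i := (Finset.mem_Icc.1 (hmem i (Finset.left_mem_Icc.2 hil)).1).1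
  have hl : l ≤ n := (Finset.mem_Icc.1 (hmem l (Finset.right_mem_Icc.2 hil)).1).2
  have hfS : ∀ j ∈ Finset.Icc i l, (-1 : ℝ) ^ j * flagVector P (S ∪ {j})
      = ∑ C ∈ flags P S, ∑ z ∈ extensions C j, (-1 : ℝ) ^ grade ℕ z := by
    intro j hj
    rw [flagVector, Finset.union_comm, ← Finset.insert_eq, flagNumber_insert (hmem j hj).2,
      Nat.cast_sum, Finset.mul_sum]
    refine Finset.sum_congr rfl fun C _ => ?_
    rw [Finset.sum_congr rfl fun z hz => by rw [(mem_extensions.1 hz).1], Finset.sum_const,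
      nsmul_eq_mul, mul_comm]
  rw [Finset.sum_congr rfl hfS, Finset.sum_comm, flagVector, flagNumber_eq_card]
  have hC : ∀ C ∈ flags P S, ∑ j ∈ Finset.Icc i l, ∑ z ∈ extensions C j, (-1 : ℝ) ^ grade ℕ z
      = -k * ((-1) ^ (i - 1) + (-1) ^ (l + 1)) := by
    intro C hC
    -- The lower end is `⊥` if `i = 1`; otherwise maximality of the gap forces `i - 1 ∈ S`, and the
    -- element of `C` of that rank serves. The upper end `y` is found dually.
    obtain ⟨x, hx, hxcomp, hxC, hxz⟩ : ∃ x : P, grade ℕ x = i - 1 ∧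
        (∀ c ∈ C, c ≤ x ∨ x ≤ c) ∧ (∀ c ∈ C, grade ℕ c < i → c ≤ x) ∧
        ∀ z, i ≤ grade ℕ z → (∀ c ∈ C, c ≤ z ∨ z ≤ c) → x < z := by
      by_cases h1 : i = 1
      · have hb : grade ℕ (⊥ : P) = 0 := by simp
        refine ⟨⊥, by omega, fun c _ => Or.inr bot_le, fun c hc hci => ?_, fun z hz _ => ?_⟩
        · have := (Finset.mem_Icc.1 (hS (grade_mem_of_mem_flags hC hc))).1
          omega
        · exact bot_lt_iff_ne_bot.2 fun he => by rw [he] at hz; omega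
      · have hiS : i - 1 ∈ S := by
          by_contra hnot
          exact hgap.left_notMem hi
            (Finset.mem_sdiff.2 ⟨Finset.mem_Icc.2 ⟨by omega, by omega⟩, hnot⟩)
        obtain ⟨x, hx, hxi⟩ := exists_mem_of_mem_flags hC hiS
        refine ⟨x, hxi, fun c hc => (mem_flags.1 hC).1.total (Finset.mem_coe.2 hc)
          (Finset.mem_coe.2 hx), fun c hc hci => ?_, fun z hz hcomp => ?_⟩
        · rcases (mem_flags.1 hC).1.total (Finset.mem_coe.2 hc) (Finset.mem_coe.2 hx) with h | h
          · exact h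
          · rcases h.eq_or_lt with rfl | h
            · exact le_rfl
            · have := grade_strictMono (𝕆 := ℕ) h
              omega
        · exact lt_of_grade_lt_of_comparable (hcomp x hx) (by omega)
    obtain ⟨y, hy, hyC, hyz⟩ : ∃ y : P, grade ℕ y = l + 1 ∧ (∀ c ∈ C, l < grade ℕ c → y ≤ c) ∧
        ∀ z, grade ℕ z ≤ l → (∀ c ∈ C, c ≤ z ∨ z ≤ c) → z < y := by
      by_cases h1 : l = n
      · refine ⟨⊤, by omega, fun c hc hci => ?_, fun z hz _ => ?_⟩
        · have := (Finset.mem_Icc.1 (hS (grade_mem_of_mem_flags hC hc))).2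
          omega
        · exact lt_top_iff_ne_top.2 fun he => by rw [he] at hz; omega
      · have hlS : l + 1 ∈ S := by
          by_contra hnot
          exact hgap.right_notMem
            (Finset.mem_sdiff.2 ⟨Finset.mem_Icc.2 ⟨by omega, by omega⟩, hnot⟩)
        obtain ⟨y, hy, hyl⟩ := exists_mem_of_mem_flags hC hlS
        refine ⟨y, hyl, fun c hc hci => ?_, fun z hz hcomp => ?_⟩
        · rcases (mem_flags.1 hC).1.total (Finset.mem_coe.2 hy) (Finset.mem_coe.2 hc) with h | h
          · exact h
          · rcases h.eq_or_lt with rfl | h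
            · exact le_rfl
            · have := grade_strictMono (𝕆 := ℕ) h
              omega
        · exact lt_of_grade_lt_of_comparable (hcomp y hy).symm (by omega)
    have hset : (Finset.Icc i l).biUnion (extensions C)
        = Finset.univ.filter fun z : P => x < z ∧ z < y := by
      ext z
      simp only [Finset.mem_biUnion, mem_extensions, Finset.mem_filter, Finset.mem_univ, true_and,
        Finset.mem_Icc]
      constructor
      · rintro ⟨j, ⟨hij, hjl⟩, rfl, hcomp⟩
        have hcomp' := fun c hc => (hcomp c hc).imp le_of_lt le_of_lt
        exact ⟨hxz z hij hcomp', hyz z hjl hcomp'⟩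
      · rintro ⟨hxz', hzy'⟩
        have h1 := grade_strictMono (𝕆 := ℕ) hxz'
        have h2 := grade_strictMono (𝕆 := ℕ) hzy'
        refine ⟨_, ⟨by omega, by omega⟩, rfl, fun c hc => ?_⟩
        have hcS := grade_mem_of_mem_flags hC hc
        have hcnot : ¬ (i ≤ grade ℕ c ∧ grade ℕ c ≤ l) := fun h =>
          (hmem _ (Finset.mem_Icc.2 h)).2 hcS
        rcases Nat.lt_or_ge (grade ℕ c) i with h | h
        · exact Or.inl ((hxC c hc h).trans_lt hxz')
        · exact Or.inr (hzy'.trans_le (hyC c hc (by omega)))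
    have hxy : x < y := hyz x (by omega) hxcomp
    rw [← Finset.sum_biUnion, hset, (isKEulerian_iff hk).1 hP x y hxy, hx, hy]
    intro j _ j' _ hne
    exact Finset.disjoint_left.2 fun z hz hz' =>
      hne ((mem_extensions.1 hz).1.symm.trans (mem_extensions.1 hz').1)
  rw [Finset.sum_congr rfl hC, Finset.sum_const, nsmul_eq_mul]
  ring

end Flags

/-! ### The test posets: chains with doubled pairs and `m` copies of inner elements. -/

section PairPoset

/-- A multiplicity `m` and starting points of disjoint pairs `{a, a + 1} ⊆ [1, n]`. -/
structure PairData (n : ℕ) where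
  m : ℕ
  A : Finset ℕ
  m_pos : 0 < m
  pos : ∀ a ∈ A, 1 ≤ a
  le : ∀ a ∈ A, a + 1 ≤ n
  succ_notMem : ∀ a ∈ A, a + 1 ∉ A

variable {n : ℕ}

/-- Elements of the poset obtained from a chain of rank `n + 1` by doubling the pairs `{a, a + 1}`
and then taking `m` copies of every element of rank in `[1, n]`. -/
@[ext]
structure PairPoset (D : PairData n) : Type u where
  rank : ℕ
  color : ℕ
  side : Bool
  rank_le : rank ≤ n + 1
  color_lt : color < D.m
  color_eq : rank = 0 ∨ rank = n + 1 → color = 0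
  side_eq : side = true → rank ∈ D.A ∨ ∃ a ∈ D.A, rank = a + 1

namespace PairPoset

variable {D : PairData n}

noncomputable instance : Fintype (PairPoset.{u} D) :=
  Fintype.ofInjective
    (fun x => ((⟨x.rank, Nat.lt_succ_of_le x.rank_le⟩, ⟨x.color, x.color_lt⟩, x.side) :
      Fin (n + 2) × Fin D.m × Bool))
    fun x y h => by
      simp only [Prod.mk.injEq, Fin.mk.injEq] at h
      exact PairPoset.ext h.1 h.2.1 h.2.2

/-- Elements are ordered by rank, where the two halves of a doubled pair are incomparable. -/
def Below (x y : PairPoset.{u} D) : Prop :=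
  x.rank < y.rank ∧ (x.rank ∈ D.A → y.rank = x.rank + 1 → x.side = y.side)

instance : PartialOrder (PairPoset.{u} D) where
  le x y := x = y ∨ Below x y
  lt x y := Below x y
  le_refl x := Or.inl rfl
  le_trans x y z := by
    rintro (rfl | h) (rfl | h')
    · exact Or.inl rfl
    · exact Or.inr h'
    · exact Or.inr h
    -- Two strict steps raise the rank by at least 2, so the side condition is vacuous.
    · exact Or.inr ⟨h.1.trans h'.1, fun _ he => by have := h.1; have := h'.1; omega⟩
  le_antisymm x y := by
    rintro (rfl | h) (h' | h')
    · rfl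
    · rfl
    · exact h'.symm
    · exact absurd (h.1.trans h'.1) (lt_irrefl _)
  lt_iff_le_not_ge x y := by
    constructor
    · intro h
      refine ⟨Or.inr h, ?_⟩
      rintro (rfl | h')
      · exact lt_irrefl _ h.1
      · exact lt_irrefl _ (h.1.trans h'.1)
    · rintro ⟨rfl | h, h'⟩
      · exact absurd (Or.inl rfl) h'
      · exact h

theorem lt_iff {x y : PairPoset.{u} D} : x < y ↔
    x.rank < y.rank ∧ (x.rank ∈ D.A → y.rank = x.rank + 1 → x.side = y.side) := Iff.rfl

theorem side_eq_false {x : PairPoset.{u} D} (h : x.rank ∉ D.A) (h' : ∀ a ∈ D.A, x.rank ≠ a + 1) :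
    x.side = false := by
  by_contra hne
  rcases x.side_eq (by simpa using hne) with h1 | ⟨a, ha, h1⟩
  · exact h h1
  · exact h' a ha h1

theorem ext_of_rank {x y : PairPoset.{u} D} (h : x.rank = y.rank)
    (h0 : x.rank = 0 ∨ x.rank = n + 1) : x = y := by
  have hside : ∀ z : PairPoset.{u} D, z.rank = 0 ∨ z.rank = n + 1 → z.side = false := by
    intro z hz
    refine side_eq_false (fun hA => ?_) (fun a hA => ?_)
    · have := D.pos _ hA
      have := D.le _ hA
      omega
    · have := D.le _ hA
      omega
  refine PairPoset.ext h ?_ ?_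
  · rw [x.color_eq h0, y.color_eq (h ▸ h0)]
  · rw [hside x h0, hside y (h ▸ h0)]

instance : BoundedOrder (PairPoset.{u} D) where
  bot := ⟨0, 0, false, Nat.zero_le _, D.m_pos, fun _ => rfl, by simp⟩
  bot_le x := by
    rcases Nat.eq_zero_or_pos x.rank with h | h
    · exact Or.inl (ext_of_rank h.symm (Or.inl rfl))
    · exact Or.inr ⟨h, fun hA => absurd (D.pos _ hA) (by simp)⟩
  top := ⟨n + 1, 0, false, le_rfl, D.m_pos, fun _ => rfl, by simp⟩
  le_top x := by
    rcases x.rank_le.eq_or_lt with h | h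
    · exact Or.inl (ext_of_rank h (Or.inr h))
    · refine Or.inr ⟨h, fun hA he => ?_⟩
      have := D.le _ hA
      dsimp only at he
      omega

/-- This makes the rank a grading. The side of the new element is forced only next to its partner
rank: by `x` if `x.rank` starts a pair, by `y` possibly if the new rank does. -/
theorem exists_between {x y : PairPoset.{u} D} (h : x.rank + 1 < y.rank) :
    ∃ z, x < z ∧ z < y := by
  have hy := y.rank_le
  by_cases hx : x.rank ∈ D.A
  · refine ⟨⟨x.rank + 1, 0, x.side, by omega, D.m_pos, fun _ => rfl, fun _ => Or.inr ⟨_, hx, rfl⟩⟩,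
      ⟨Nat.lt_succ_self _, fun _ _ => rfl⟩, h, fun hA => absurd hA (D.succ_notMem _ hx)⟩
  · by_cases hx' : x.rank + 1 ∈ D.A
    · exact ⟨⟨x.rank + 1, 0, y.side, by omega, D.m_pos, fun _ => rfl, fun _ => Or.inl hx'⟩,
        ⟨Nat.lt_succ_self _, fun hA => absurd hA hx⟩, h, fun _ _ => rfl⟩
    · exact ⟨⟨x.rank + 1, 0, false, by omega, D.m_pos, fun _ => rfl, by simp⟩,
        ⟨Nat.lt_succ_self _, fun hA => absurd hA hx⟩, h, fun hA => absurd hA hx'⟩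

instance : GradeMinOrder ℕ (PairPoset.{u} D) where
  grade := rank
  grade_strictMono _ _ h := h.1
  covBy_grade {x y} hc := by
    have hlt := hc.1.1
    rw [Nat.covBy_iff_add_one_eq]
    by_contra hne
    obtain ⟨z, hxz, hzy⟩ := exists_between (x := x) (y := y) (by omega)
    exact hc.2 hxz hzy
  isMin_grade {x} h := by
    rw [h.eq_bot]
    exact isMin_bot

theorem grade_eq (x : PairPoset.{u} D) : grade ℕ x = x.rank := rfl

theorem grade_top : grade ℕ (⊤ : PairPoset.{u} D) = n + 1 := rfl

open Classical in
theorem card_filter_rank_side {t : ℕ} (ht : t ∈ Finset.Icc 1 n) (B : Finset Bool)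
    (hB : true ∈ B → t ∈ D.A ∨ ∃ a ∈ D.A, t = a + 1) :
    (Finset.univ.filter fun z : PairPoset.{u} D => z.rank = t ∧ z.side ∈ B).card
      = D.m * B.card := by
  rw [Finset.mem_Icc] at ht
  rw [← Finset.card_range D.m, ← Finset.card_product]
  refine Finset.card_bij (fun z _ => (z.color, z.side)) ?_ ?_ ?_
  · intro z hz
    obtain ⟨-, -, h⟩ := Finset.mem_filter.1 hz
    exact Finset.mem_product.2 ⟨Finset.mem_range.2 z.color_lt, h⟩
  · intro z hz z' hz' h
    rw [Prod.mk.injEq] at h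
    exact PairPoset.ext
      ((Finset.mem_filter.1 hz).2.1.trans (Finset.mem_filter.1 hz').2.1.symm) h.1 h.2
  · rintro ⟨c, b⟩ h
    obtain ⟨hc, hb⟩ := Finset.mem_product.1 h
    exact ⟨⟨t, c, b, by omega, Finset.mem_range.1 hc, fun h0 => by omega, fun hb' => hB (hb' ▸ hb)⟩,
      Finset.mem_filter.2 ⟨Finset.mem_univ _, rfl, hb⟩, rfl⟩

open Classical in
-- Both sides are available at a doubled rank unless the partner rank is that of `x` or `y`, whose
-- side is then forced.
theorem card_filter_between {x y : PairPoset.{u} D} {j : ℕ} (hxj : x.rank < j) (hjy : j < y.rank) :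
    (Finset.univ.filter fun z : PairPoset.{u} D => z.rank = j ∧ x < z ∧ z < y).card
      = D.m * (1 + (if j ∈ D.A ∧ j + 1 < y.rank then 1 else 0)
          + if ∃ a ∈ D.A, j = a + 1 ∧ x.rank < a then 1 else 0) := by
  have hy := y.rank_le
  have hj : j ∈ Finset.Icc 1 n := Finset.mem_Icc.2 ⟨by omega, by omega⟩
  have main : ∀ B : Finset Bool, (true ∈ B → j ∈ D.A ∨ ∃ a ∈ D.A, j = a + 1) →
      (∀ z : PairPoset.{u} D, z.rank = j → (x < z ∧ z < y ↔ z.side ∈ B)) →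
      (Finset.univ.filter fun z : PairPoset.{u} D => z.rank = j ∧ x < z ∧ z < y).card
        = D.m * B.card := by
    intro B hB hz
    rw [← card_filter_rank_side hj B hB]
    congr 1
    ext z
    simp only [Finset.mem_filter, Finset.mem_univ, true_and]
    exact and_congr_right (hz z)
  by_cases h1 : j ∈ D.A
  · have hno : ∀ a ∈ D.A, j ≠ a + 1 := fun a ha he => D.succ_notMem a ha (he ▸ h1)
    have hno' : ¬ ∃ a ∈ D.A, j = a + 1 ∧ x.rank < a := fun ⟨a, ha, he, _⟩ => hno a ha he
    by_cases h2 : j + 1 < y.rank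
    · rw [main Finset.univ (fun _ => Or.inl h1), if_pos ⟨h1, h2⟩, if_neg hno']
      · simp
      · intro z hz
        refine iff_of_true ⟨⟨by omega, fun hA he => absurd (hz ▸ he) (hno _ hA)⟩, by omega,
          fun _ he => by omega⟩ (Finset.mem_univ _)
    · rw [main {y.side} (fun _ => Or.inl h1), if_neg (fun h => h2 h.2), if_neg hno']
      · simp
      · intro z hz
        rw [Finset.mem_singleton, lt_iff, lt_iff, hz]
        exact ⟨fun h => h.2.2 h1 (by omega), fun h => ⟨⟨hxj, fun hA he => absurd he (hno _ hA)⟩,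
          hjy, fun _ _ => h⟩⟩
  · by_cases h2 : ∃ a ∈ D.A, j = a + 1
    · obtain ⟨a, ha, rfl⟩ := h2
      by_cases h3 : x.rank < a
      · rw [main Finset.univ (fun _ => Or.inr ⟨a, ha, rfl⟩), if_neg (fun h => h1 h.1),
          if_pos ⟨a, ha, rfl, h3⟩]
        · simp
        · intro z hz
          refine iff_of_true ⟨⟨by omega, fun hA he => by omega⟩, by omega,
            fun hA => absurd (hz ▸ hA) h1⟩ (Finset.mem_univ _)
      · have hxa : x.rank = a := by omega
        rw [main {x.side} (fun _ => Or.inr ⟨a, ha, rfl⟩), if_neg (fun h => h1 h.1), if_neg]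
        · simp
        · rintro ⟨b, hb, he, hlt⟩
          omega
        · intro z hz
          rw [Finset.mem_singleton, lt_iff, lt_iff, hz, hxa]
          exact ⟨fun h => (h.1.2 ha rfl).symm, fun h => ⟨⟨by omega, fun _ _ => h.symm⟩,
            hjy, fun hA => absurd hA h1⟩⟩
    · rw [main {false} (by simp), if_neg (fun h => h1 h.1), if_neg]
      · simp
      · rintro ⟨a, ha, he, -⟩
        exact h2 ⟨a, ha, he⟩
      · intro z hz
        rw [Finset.mem_singleton, lt_iff, lt_iff, hz]
        refine iff_of_true ⟨⟨hxj, fun hA he => absurd ⟨_, hA, he⟩ h2⟩, hjy,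
          fun hA => absurd hA h1⟩ (side_eq_false (hz ▸ h1) fun a ha he => h2 ⟨a, ha, hz ▸ he⟩)

/-- The surplus elements at ranks `a` and `a + 1` appear together, exactly when both ranks are
strictly inside the interval, and cancel. What remains is `m = 2k` times the alternating sum of a
chain. For `n = 0` the only open interval is empty and any `m` works. -/
theorem isKEulerian {k : ℝ} (hk : k ≠ 0) (h : n = 0 ∨ 2 * k = D.m) :
    IsKEulerian (PairPoset.{u} D) k := by
  classical
  rw [isKEulerian_iff hk]
  intro x y hxy
  have hlt : x.rank < y.rank := hxy.1
  have hsplit : ∑ z ∈ Finset.univ.filter (fun z : PairPoset.{u} D => x < z ∧ z < y),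
      (-1 : ℝ) ^ grade ℕ z
      = ∑ j ∈ Finset.Icc (x.rank + 1) (y.rank - 1), (-1) ^ j * ((D.m : ℝ) *
          (1 + (if j ∈ D.A ∧ j + 1 < y.rank then 1 else 0)
          + if ∃ a ∈ D.A, j = a + 1 ∧ x.rank < a then 1 else 0)) := by
    rw [← Finset.sum_fiberwise_of_maps_to (g := rank)
      (t := Finset.Icc (x.rank + 1) (y.rank - 1))]
    · refine Finset.sum_congr rfl fun j hj => ?_
      rw [Finset.mem_Icc] at hj
      have hcard := card_filter_between (x := x) (y := y) (j := j) (by omega) (by omega)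
      rw [Finset.sum_congr rfl fun z hz => by rw [grade_eq, (Finset.mem_filter.1 hz).2],
        Finset.sum_const, nsmul_eq_mul, mul_comm, Finset.filter_filter]
      congr 1
      simp only [and_comm (b := rank _ = j)]
      rw [hcard]
      push_cast
      rfl
    · intro z hz
      obtain ⟨-, h1, h2⟩ := Finset.mem_filter.1 hz
      have := h1.1
      have := h2.1
      exact Finset.mem_Icc.2 ⟨by omega, by omega⟩
  have hcancel : ∑ j ∈ Finset.Icc (x.rank + 1) (y.rank - 1), (-1 : ℝ) ^ j *
      (if ∃ a ∈ D.A, j = a + 1 ∧ x.rank < a then 1 else 0)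
      = - ∑ j ∈ Finset.Icc (x.rank + 1) (y.rank - 1), (-1 : ℝ) ^ j *
      (if j ∈ D.A ∧ j + 1 < y.rank then 1 else 0) := by
    simp only [mul_ite, mul_one, mul_zero]
    rw [← Finset.sum_filter, ← Finset.sum_filter, ← Finset.sum_neg_distrib]
    symm
    refine Finset.sum_bij (fun j _ => j + 1) ?_ (by simp) ?_ fun j _ => by ring
    · intro j hj
      simp only [Finset.mem_filter, Finset.mem_Icc] at hj ⊢
      exact ⟨⟨by omega, by omega⟩, j, hj.2.1, rfl, by omega⟩
    · intro j hj
      simp only [Finset.mem_filter, Finset.mem_Icc] at hj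
      obtain ⟨hj, a, ha, rfl, hxa⟩ := hj
      exact ⟨a, Finset.mem_filter.2 ⟨Finset.mem_Icc.2 ⟨by omega, by omega⟩, ha, by omega⟩, rfl⟩
  have hchain := two_mul_sum_Icc_neg_one_pow (i := x.rank + 1) (l := y.rank - 1)
    (by omega) (by omega)
  rw [Nat.add_sub_cancel, Nat.sub_add_cancel (by omega)] at hchain
  rw [hsplit, grade_eq, grade_eq]
  have hsum : ∀ (I : Finset ℕ) (g h : ℕ → ℝ), ∑ j ∈ I, (-1) ^ j * ((D.m : ℝ) * (1 + g j + h j))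
      = D.m * (∑ j ∈ I, (-1) ^ j + ∑ j ∈ I, (-1) ^ j * g j + ∑ j ∈ I, (-1) ^ j * h j) := by
    intro I g h
    rw [← Finset.sum_add_distrib, ← Finset.sum_add_distrib, Finset.mul_sum]
    exact Finset.sum_congr rfl fun _ _ => by ring
  rw [hsum, hcancel]
  rcases h with rfl | h
  · have hy := y.rank_le
    rw [show x.rank = 0 by omega, show y.rank = 1 by omega]
    simp
  · rw [← h]
    linear_combination k * hchain

open Classical in
-- Since `T` lies below `t`, the side at rank `t` is constrained only if `C` already contains an
-- element of the lower rank of the same pair.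
theorem card_extensions {T : Finset ℕ} {t : ℕ} (ht : t ∈ Finset.Icc 1 n) (hT : ∀ s ∈ T, s < t)
    {C : Finset (PairPoset.{u} D)} (hC : C ∈ flags (PairPoset.{u} D) T) :
    (extensions C t).card
      = D.m * if t ∈ D.A ∨ ∃ a ∈ D.A, t = a + 1 ∧ a ∉ T then 2 else 1 := by
  have main : ∀ B : Finset Bool, (true ∈ B → t ∈ D.A ∨ ∃ a ∈ D.A, t = a + 1) →
      (∀ z : PairPoset.{u} D, z.rank = t → ((∀ c ∈ C, c < z) ↔ z.side ∈ B)) →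
      (extensions C t).card = D.m * B.card := by
    intro B hB hz
    rw [← card_filter_rank_side ht B hB]
    congr 1
    ext z
    simp only [mem_extensions, Finset.mem_filter, Finset.mem_univ, true_and, grade_eq]
    refine and_congr_right fun hzt => ?_
    rw [← hz z hzt]
    refine forall₂_congr fun c hc => ⟨fun h => h.resolve_right fun h' => ?_, Or.inl⟩
    have h1 := h'.1
    have h2 := hT _ (grade_mem_of_mem_flags hC hc)
    rw [grade_eq] at h2
    omega
  have hlt : ∀ c ∈ C, c.rank < t := fun c hc => hT _ (grade_mem_of_mem_flags hC hc)
  by_cases h1 : t ∈ D.A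
  · rw [main Finset.univ (fun _ => Or.inl h1), if_pos (Or.inl h1)]
    · simp
    · exact fun z hz => iff_of_true (fun c hc => ⟨hz ▸ hlt c hc, fun hA he =>
        absurd (he ▸ hz ▸ h1) (D.succ_notMem _ hA)⟩) (Finset.mem_univ _)
  · by_cases h2 : ∃ a ∈ D.A, t = a + 1
    · obtain ⟨a, ha, rfl⟩ := h2
      by_cases h3 : a ∈ T
      · obtain ⟨c, hc, hca⟩ := exists_mem_of_mem_flags hC h3
        rw [grade_eq] at hca
        rw [main {c.side} (fun _ => Or.inr ⟨a, ha, rfl⟩), if_neg]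
        · simp
        · rintro (h | ⟨b, -, he, hb⟩)
          · exact h1 h
          · obtain rfl : a = b := by omega
            exact hb h3
        · intro z hz
          rw [Finset.mem_singleton]
          refine ⟨fun h => ((h c hc).2 (hca ▸ ha) (by omega)).symm, fun h c' hc' =>
            ⟨hz ▸ hlt c' hc', fun hA he => ?_⟩⟩
          have hcc : c' = c := by
            by_contra hne
            have hr : c'.rank = c.rank := by omega
            rcases (mem_flags.1 hC).1.total (Finset.mem_coe.2 hc) (Finset.mem_coe.2 hc') with
              (h' | h') | (h' | h')
            · exact hne h'.symm
            · have := h'.1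
              omega
            · exact hne h'
            · have := h'.1
              omega
          rw [hcc, h]
      · rw [main Finset.univ (fun _ => Or.inr ⟨a, ha, rfl⟩), if_pos (Or.inr ⟨a, ha, rfl, h3⟩)]
        · simp
        · refine fun z hz => iff_of_true (fun c hc => ⟨hz ▸ hlt c hc, fun hA he => ?_⟩)
            (Finset.mem_univ _)
          have hca : c.rank = a := by omega
          exact absurd (hca ▸ grade_mem_of_mem_flags hC hc) h3
    · rw [main {false} (by simp), if_neg]
      · simp
      · rintro (h | ⟨a, ha, he, -⟩)
        · exact h1 h
        · exact h2 ⟨a, ha, he⟩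
      · intro z hz
        rw [Finset.mem_singleton]
        exact iff_of_true (fun c hc => ⟨hz ▸ hlt c hc, fun hA he => absurd ⟨_, hA, hz ▸ he⟩ h2⟩)
          (side_eq_false (hz ▸ h1) fun a ha he => h2 ⟨a, ha, hz ▸ he⟩)

/-- Chains are built from the bottom up: each rank contributes `m`, and a pair contributes `2` when
it is first met, after which its side is fixed. -/
theorem flagNumber_eq {T : Finset ℕ} (hT : T ⊆ Finset.Icc 1 n) :
    flagNumber (PairPoset.{u} D) T
      = D.m ^ T.card * 2 ^ (D.A.filter fun a => a ∈ T ∨ a + 1 ∈ T).card := by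
  classical
  induction T using Finset.induction_on_max with
  | empty => simp [flagNumber_empty]
  | insert t T hlt ih =>
    have htT : t ∉ T := fun h => lt_irrefl _ (hlt t h)
    have htT' : t + 1 ∉ T := fun h => by have := hlt _ h; omega
    have hcard : 2 ^ (D.A.filter fun a => a ∈ insert t T ∨ a + 1 ∈ insert t T).card
        = 2 ^ (D.A.filter fun a => a ∈ T ∨ a + 1 ∈ T).card
          * if t ∈ D.A ∨ ∃ a ∈ D.A, t = a + 1 ∧ a ∉ T then 2 else 1 := by
      have key : ∀ b ∈ D.A, b ∉ T → b + 1 ∉ T → (b = t ∨ b + 1 = t) →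
          2 ^ (D.A.filter fun a => a ∈ insert t T ∨ a + 1 ∈ insert t T).card
            = 2 ^ (D.A.filter fun a => a ∈ T ∨ a + 1 ∈ T).card * 2 := by
        intro b hb hbT hbT' hbt
        rw [← pow_succ, ← Finset.card_insert_of_notMem (a := b)]
        · congr 2
          ext a
          simp only [Finset.mem_filter, Finset.mem_insert]
          constructor
          · rintro ⟨ha, (h | h) | (h | h)⟩
            · refine Or.inl ?_
              rcases hbt with hbt | hbt
              · omega
              · exact absurd (by rwa [hbt, ← h]) (D.succ_notMem b hb)
            · exact Or.inr ⟨ha, Or.inl h⟩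
            · refine Or.inl ?_
              rcases hbt with hbt | hbt
              · exact absurd (by rwa [h, ← hbt]) (D.succ_notMem a ha)
              · omega
            · exact Or.inr ⟨ha, Or.inr h⟩
          · rintro (rfl | ⟨ha, h | h⟩)
            · exact ⟨hb, hbt.imp Or.inl Or.inl⟩
            · exact ⟨ha, Or.inl (Or.inr h)⟩
            · exact ⟨ha, Or.inr (Or.inr h)⟩
        · exact fun h => (Finset.mem_filter.1 h).2.elim hbT hbT'
      split_ifs with h
      · rcases h with h | ⟨a, ha, rfl, haT⟩
        · exact key t h htT htT' (Or.inl rfl)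
        · exact key a ha haT htT (Or.inr rfl)
      · push Not at h
        rw [mul_one]
        congr 2
        refine Finset.filter_congr fun a ha => ?_
        simp only [Finset.mem_insert]
        constructor
        · rintro ((rfl | h') | (h' | h'))
          · exact absurd ha h.1
          · exact Or.inl h'
          · exact Or.inl (h.2 a ha h'.symm)
          · exact Or.inr h'
        · exact Or.imp Or.inr Or.inr
    rw [flagNumber_insert htT, Finset.sum_congr rfl fun C hC =>
      card_extensions (hT (Finset.mem_insert_self t T)) hlt hC, Finset.sum_const,
      ← flagNumber_eq_card, ih ((Finset.subset_insert t T).trans hT), hcard,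
      Finset.card_insert_of_notMem htT, smul_eq_mul, pow_succ]
    ring

end PairPoset

end PairPoset

/-! ### Completeness of the equations. -/

section Spanning

/-- Expanding `x a = 2 - (2 - x a)` writes the product as a combination of the products over `C ⊆
A`. -/
theorem map_mul_prod_eq_zero {R : Type*} [CommRing R] [Algebra ℝ R] (L : R →ₗ[ℝ] ℝ) (w : R)
    (x : ℕ → R) (A : Finset ℕ) (h : ∀ C ⊆ A, L (w * ∏ c ∈ C, (2 - x c)) = 0) :
    L (w * ∏ a ∈ A, x a) = 0 := by
  classical
  -- Mixed products allow the factors to be exchanged one at a time.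
  have main : ∀ B C : Finset ℕ, B ⊆ A → C ⊆ A → Disjoint B C →
      L (w * (∏ b ∈ B, x b) * ∏ c ∈ C, (2 - x c)) = 0 := by
    intro B
    induction B using Finset.induction_on with
    | empty =>
      intro C _ hC _
      rw [Finset.prod_empty, mul_one]
      exact h C hC
    | insert b B hb ih =>
      intro C hBA hC hdisj
      rw [Finset.disjoint_insert_left] at hdisj
      have hB := (Finset.subset_insert b B).trans hBA
      have h1 := ih C hB hC hdisj.2
      have h2 := ih (insert b C) hB
        (Finset.insert_subset (hBA (Finset.mem_insert_self b B)) hC)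
        (Finset.disjoint_insert_right.2 ⟨hb, hdisj.2⟩)
      rw [Finset.prod_insert hdisj.1] at h2
      rw [Finset.prod_insert hb]
      have h3 : w * (x b * ∏ b ∈ B, x b) * ∏ c ∈ C, (2 - x c)
          = (2 : ℝ) • (w * (∏ b ∈ B, x b) * ∏ c ∈ C, (2 - x c))
            - w * (∏ b ∈ B, x b) * ((2 - x b) * ∏ c ∈ C, (2 - x c)) := by
        rw [Algebra.smul_def, map_ofNat]
        ring
      rw [h3, map_sub, map_smul, h1, h2, smul_zero, sub_zero]
  have := main A ∅ subset_rfl (Finset.empty_subset _) (Finset.disjoint_empty_right _)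
  simpa using this

/-- A linear relation among the flag numbers of all `k`-Eulerian posets of rank `n + 1` annihilates
the vectors `T ↦ (2k)^{|T|} [T ∩ E = ∅]` for even sets `E`. -/
theorem sum_eq_zero_of_isEvenSet {n : ℕ} {k : ℝ} (hk : k ≠ 0)
    (h : n = 0 ∨ ∃ m : ℕ, 0 < m ∧ 2 * k = m) {a : Finset ℕ →₀ ℝ}
    (ha : ∀ S ∈ a.support, S ⊆ Finset.Icc 1 n)
    (hrel : ∀ (P : Type u) [PartialOrder P] [BoundedOrder P] [Fintype P] [GradeMinOrder ℕ P],
      grade ℕ (⊤ : P) = n + 1 → IsKEulerian P k → Finsupp.linearCombination ℝ (flagVector P) a = 0)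
    {E : Finset ℕ} (hE : IsEvenSet E) (hEn : E ⊆ Finset.Icc 1 n) :
    ∑ T ∈ a.support, a T * ((2 * k) ^ T.card * if Disjoint E T then 1 else 0) = 0 := by
  obtain ⟨A, hA⟩ := hE.exists_isPairing
  -- For `n = 0` only `T = ∅` occurs, so the arbitrary choice `m = 1` does no harm.
  obtain ⟨m, hm, hkm⟩ : ∃ m : ℕ, 0 < m ∧ (n = 0 ∨ 2 * k = m) := by
    rcases h with h | ⟨m, hm, hkm⟩
    · exact ⟨1, one_pos, Or.inl h⟩
    · exact ⟨m, hm, Or.inr hkm⟩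
  have hpow : ∀ T ∈ a.support, (2 * k) ^ T.card = (m : ℝ) ^ T.card := by
    intro T hT
    rcases hkm with rfl | hkm
    · have hT0 := ha T hT
      rw [Finset.Icc_eq_empty (by omega), Finset.subset_empty] at hT0
      simp [hT0]
    · rw [hkm]
  have hAn : ∀ c ∈ A, 1 ≤ c ∧ c + 1 ≤ n := fun c hc =>
    ⟨(Finset.mem_Icc.1 (hEn ((hA.mem_iff c).2 (Or.inl hc)))).1,
      (Finset.mem_Icc.1 (hEn ((hA.mem_iff (c + 1)).2 (Or.inr ⟨c, hc, rfl⟩)))).2⟩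
  -- The indicator that `T` misses `{c, c + 1}`: the product over `A` tests `T ∩ E = ∅`, while `2 -
  -- x c` is the factor of a doubled pair in a flag number.
  let x : ℕ → Finset ℕ → ℝ := fun c T => if c ∈ T ∨ c + 1 ∈ T then 0 else 1
  let L : (Finset ℕ → ℝ) →ₗ[ℝ] ℝ := ∑ T ∈ a.support, a T • LinearMap.proj T
  have hL : ∀ g : Finset ℕ → ℝ, L g = ∑ T ∈ a.support, a T * g T := fun g => by
    simp [L, LinearMap.sum_apply]
  have key := map_mul_prod_eq_zero L (fun T => (m : ℝ) ^ T.card) x A fun C hC => by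
    let D : PairData n := ⟨m, C, hm, fun c hc => (hAn c (hC hc)).1, fun c hc => (hAn c (hC hc)).2,
      fun c hc h' => hA.succ_notMem c (hC hc) (hC h')⟩
    rw [← hrel (PairPoset.{u} D) PairPoset.grade_top (PairPoset.isKEulerian hk hkm), hL,
      Finsupp.linearCombination_apply, Finsupp.sum]
    refine Finset.sum_congr rfl fun T hT => ?_
    rw [smul_eq_mul, flagVector, PairPoset.flagNumber_eq (ha T hT), Pi.mul_apply,
      Finset.prod_apply]
    have hprod : ∏ c ∈ C, (2 - x c) T = ∏ c ∈ C, if c ∈ T ∨ c + 1 ∈ T then (2 : ℝ) else 1 := by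
      refine Finset.prod_congr rfl fun c _ => ?_
      simp only [x, Pi.sub_apply, Pi.ofNat_apply]
      split_ifs <;> norm_num
    rw [hprod, Finset.prod_ite, Finset.prod_const, Finset.prod_const_one, mul_one]
    push_cast
    rfl
  rw [hL] at key
  refine Eq.trans ?_ key
  refine Finset.sum_congr rfl fun T hT => ?_
  rw [hpow T hT, Pi.mul_apply, Finset.prod_apply]
  congr 2
  simp only [x]
  split_ifs with hdisj
  · refine (Finset.prod_eq_one fun c hc => if_neg ?_).symm
    rintro (h' | h')
    · exact Finset.disjoint_left.1 hdisj ((hA.mem_iff c).2 (Or.inl hc)) h'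
    · exact Finset.disjoint_left.1 hdisj ((hA.mem_iff _).2 (Or.inr ⟨c, hc, rfl⟩)) h'
  · obtain ⟨y, hyE, hyT⟩ := Finset.not_disjoint_iff.1 hdisj
    rcases (hA.mem_iff y).1 hyE with hy | ⟨c, hc, rfl⟩
    · exact (Finset.prod_eq_zero hy (by rw [if_pos (Or.inl hyT)])).symm
    · exact (Finset.prod_eq_zero hc (by rw [if_pos (Or.inr hyT)])).symm

/-- Every linear relation among the flag numbers of `k`-Eulerian posets is a combination of the
Dehn–Sommerville forms. -/
theorem mem_span_dehnSommervilleForm {n : ℕ} {k : ℝ} (hk : k ≠ 0)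
    (h : n = 0 ∨ ∃ m : ℕ, 0 < m ∧ 2 * k = m) {a : Finset ℕ →₀ ℝ}
    (ha : ∀ S ∈ a.support, S ⊆ Finset.Icc 1 n)
    (hrel : ∀ (P : Type u) [PartialOrder P] [BoundedOrder P] [Fintype P] [GradeMinOrder ℕ P],
      grade ℕ (⊤ : P) = n + 1 → IsKEulerian P k →
        Finsupp.linearCombination ℝ (flagVector P) a = 0) :
    a ∈ Submodule.span ℝ {b : Finset ℕ →₀ ℝ | ∃ S ⊆ Finset.Icc 1 n, ∃ i l : ℕ,
          IsMaximalGap n S i l ∧ b = dehnSommervilleForm k S i l} := by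
  by_contra hnot
  obtain ⟨φ, hφa, hφ⟩ := Submodule.exists_le_ker_of_notMem hnot
  apply hφa
  -- The separating functional, read on basis vectors, is a solution of the equations; it remains to
  -- show that `a` vanishes on it.
  let f : Finset ℕ → ℝ := fun S => φ (Finsupp.single S 1)
  have hφf : ∀ b, φ b = Finsupp.linearCombination ℝ f b := by
    intro b
    have : φ = Finsupp.linearCombination ℝ f := by
      ext S
      simp [f]
    rw [this]
  have hf : SatisfiesDehnSommerville k n f := by
    intro S hS i l hgap
    rw [← linearCombination_dehnSommervilleForm, ← hφf]
    exact hφ (Submodule.subset_span ⟨S, hS, i, l, hgap, rfl⟩)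
  rw [satisfiesDehnSommerville_iff hk] at hf
  have hfT : ∀ T ∈ a.support, a T • f T = ∑ E ∈ (Finset.Icc 1 n).powerset, LVector k n f E *
      (a T * ((2 * k) ^ T.card * if Disjoint E T then 1 else 0)) := by
    intro T hT
    rw [eq_sum_LVector hk n f (ha T hT), smul_eq_mul, ← mul_assoc, Finset.mul_sum]
    have hset : (Finset.Icc 1 n \ T).powerset
        = (Finset.Icc 1 n).powerset.filter fun E => Disjoint E T := by
      ext E
      simp only [Finset.mem_powerset, Finset.mem_filter, Finset.subset_sdiff]
    rw [hset, Finset.sum_filter]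
    refine Finset.sum_congr rfl fun E _ => ?_
    split_ifs <;> ring
  rw [hφf, Finsupp.linearCombination_apply, Finsupp.sum, Finset.sum_congr rfl hfT, Finset.sum_comm]
  refine Finset.sum_eq_zero fun E hE => ?_
  rw [Finset.mem_powerset] at hE
  rw [← Finset.mul_sum]
  by_cases hev : IsEvenSet E
  · rw [sum_eq_zero_of_isEvenSet hk h ha hrel hev hE, mul_zero]
  · rw [hf E hE hev, zero_mul]

end Spanning

theorem mainTheorem3 (n : ℕ) (k : ℝ) (hk : k ≠ 0) :
    -- the equations hold for every `k`-Eulerian poset of rank `n + 1`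
    (∀ (P : Type u) [PartialOrder P] [BoundedOrder P] [Fintype P] [GradeMinOrder ℕ P],
      grade ℕ (⊤ : P) = n + 1 → IsKEulerian P k → SatisfiesDehnSommerville k n (flagVector P)) ∧
    -- every linear relation valid for all these posets is a linear combination of the equations
    ((n = 0 ∨ ∃ m : ℕ, 0 < m ∧ 2 * k = m) →
      ∀ a : Finset ℕ →₀ ℝ, (∀ S ∈ a.support, S ⊆ Finset.Icc 1 n) →
        (∀ (P : Type u) [PartialOrder P] [BoundedOrder P] [Fintype P] [GradeMinOrder ℕ P],
          grade ℕ (⊤ : P) = n + 1 → IsKEulerian P k →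
            Finsupp.linearCombination ℝ (flagVector P) a = 0) →
        a ∈ Submodule.span ℝ {b : Finset ℕ →₀ ℝ | ∃ S ⊆ Finset.Icc 1 n, ∃ i l : ℕ,
          IsMaximalGap n S i l ∧ b = dehnSommervilleForm k S i l}) ∧
    -- the equations are equivalent to the vanishing of the non-even part of the `L^k`-vector
    (∀ f : Finset ℕ → ℝ, SatisfiesDehnSommerville k n f ↔
      ∀ S ⊆ Finset.Icc 1 n, ¬ IsEvenSet S → LVector k n f S = 0) ∧
    -- in particular that part vanishes for every `k`-Eulerian poset of rank `n + 1`
    (∀ (P : Type u) [PartialOrder P] [BoundedOrder P] [Fintype P] [GradeMinOrder ℕ P],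
      grade ℕ (⊤ : P) = n + 1 → IsKEulerian P k →
        ∀ S ⊆ Finset.Icc 1 n, ¬ IsEvenSet S → LVector k n (flagVector P) S = 0) := by
  exact ⟨fun P _ _ _ _ hn hP => hP.satisfiesDehnSommerville hk hn,
    fun h _ ha hrel => mem_span_dehnSommervilleForm hk h ha hrel,
    satisfiesDehnSommerville_iff hk n,
    fun P _ _ _ _ hn hP =>
      (satisfiesDehnSommerville_iff hk n _).1 (hP.satisfiesDehnSommerville hk hn)⟩
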